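/- Let $\Omega$ be a finite set (of pixels), $X=\mathbb{R}^\Omega$ with the Euclidean norm, $A:X\to Y$ a bounded linear operator into a real inner product space, $u_0\in Y$, $\nabla=[\nabla_1,\nabla_2]^T$ with linear operators $\nabla_1,\nabla_2:X\to\mathbb{R}^\Omega$ (the components of a discrete gradient), and $\lambda,\mu>0$. Put $f(u)=\tfrac12\|Au-u_0\|^2$ and $|\nabla u|_p^2=\sum_{l=1}^2(\nabla_l u)_p^2$, and let $F=f+P_1-P_2$, where in the isotropic case $$P_1(u)=\tfrac{\mu}{2}\sum_{p\in\Omega}\big(|\nabla u|_p^2+\tfrac{\lambda}{\mu}\big),\qquad P_2(u)=\tfrac{\mu}{2}\sum_{p\in\Omega}\max\big(|\nabla u|_p^2,\tfrac{\lambda}{\mu}\big),$$ and in the anisotropic case $$P_1(u)=\tfrac{\mu}{2}\sum_{l=1}^2\sum_{p\in\Omega}\big((\nabla_l u)_p^2+\tfrac{\lambda}{\mu}\big),\qquad P_2(u)=\tfrac{\mu}{2}\sum_{l=1}^2\sum_{p\in\Omega}\max\big((\nabla_l u)_p^2,\tfrac{\lambda}{\mu}\big).$$ Thus $P_1-P_2$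 is the truncated quadratic regularization $\tfrac{\mu}{2}\sum_p\min(|\nabla u|_p^2,\tfrac{\lambda}{\mu})$, respectively $\tfrac{\mu}{2}\sum_l\sum_p\min((\nabla_l u)_p^2,\tfrac{\lambda}{\mu})$. Assume that $F$ is level-bounded, i.e. $\{u: F(u)\le\alpha\}$ is bounded for every $\alpha\in\mathbb{R}$. Let $L\ge 0$ be a Lipschitz constant of $\nabla f$ (here $\nabla f$ is the gradient of $f$), and let $M:X\to X$ be linear, self-adjoint and positive definite with $M\ge L I$; write $\|u\|_M^2=\langle u,Mu\rangle$. Let $(x^t)_{t\ge0}$ be generated by the preconditioned difference-of-convex algorithm with extrapolation (preDCA$_e$): $x^{-1}=x^0\in X$, $\beta_t\in[0,1)$ with $\sup_t\beta_t<1$, and for $t=0,1,2,\dots$ $$\xi^t\in\partial P_2(x^t),\qquad y^t=x^t+\beta_t(x^t-x^{t-1}),\qquad x^{t+1}=\operatorname*{arg\,min}_{z\in X}\Big\{\langle\nabla f(y^t)-\xi^t,z\rangle+\tfrac12\|z-y^t\|_M^2+P_1(z)\Big\},$$ where $\partial P_2$ is the convex subdifferential. Suppose that $x^t\to\bar x$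 for some $\bar x \in X$, and that $E(x,y)=F(x)+\tfrac12\|x-y\|_M^2$ on $X\times X$ is a Kurdyka-Łojasiewicz (KL) function with exponent $\tfrac12$, i.e. for every $\bar z$ with $\partial E(\bar z)\neq\emptyset$ there are $c>0$, $a\in(0,+\infty]$ and a neighbourhood $O$ of $\bar z$ such that, with $\psi(s)=c\,s^{1/2}$, $$\psi'\big(E(z)-E(\bar z)\big)\,\operatorname{dist}\big(0,\partial E(z)\big)\ge1\quad\text{for all } z\in O \text{ with } E(\bar z)<E(z)<E(\bar z)+a,$$ where $\partial E$ is the limiting subdifferential and $\operatorname{dist}(0,\emptyset)=+\infty$. Then there are $c_1>0$, an integer $t_0>0$ and $\eta\in(0,1)$ such that $\|x^t-\bar x\|<c_1\eta^t$ for all $t>t_0$; that is, $x^t$ converges to $\bar x$ locally linearly. -/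

import Mathlib

open Filter Topology
open scoped ENNReal NNReal RealInnerProductSpace

noncomputable section

/-! ### Subdifferentials -/

/-- The subdifferential of a finite-valued convex function, in the sense of convex analysis. -/
def convexSubdiff {V : Type*} [NormedAddCommGroup V] [InnerProductSpace ℝ V]
    (g : V → ℝ) (x : V) : Set V :=
  {ξ | ∀ y, g x + ⟪ξ, y - x⟫ ≤ g y}

/-- The Fréchet (regular) subdifferential: `ξ` such that
`liminf_{y → x, y ≠ x} (h y - h x - ⟨ξ, y - x⟩) / ‖y - x‖ ≥ 0`. -/
def frechetSubdiff {V : Type*} [NormedAddCommGroup V] [InnerProductSpace ℝ V]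
    (h : V → ℝ) (x : V) : Set V :=
  {ξ | ∀ ε : ℝ, 0 < ε → ∀ᶠ y in 𝓝[≠] x, -ε ≤ (h y - h x - ⟪ξ, y - x⟫) / ‖y - x‖}

/-- The limiting subdifferential: limits of Fréchet subgradients `ξₙ` of `h` at points `xₙ → x`
with `h xₙ → h x`. -/
def limitingSubdiff {V : Type*} [NormedAddCommGroup V] [InnerProductSpace ℝ V]
    (h : V → ℝ) (x : V) : Set V :=
  {ξ | ∃ (xs ξs : ℕ → V), Tendsto xs atTop (𝓝 x) ∧ Tendsto (fun n => h (xs n)) atTop (𝓝 (h x)) ∧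
    Tendsto ξs atTop (𝓝 ξ) ∧ ∀ n, ξs n ∈ frechetSubdiff h (xs n)}

/-! ### The Kurdyka-Łojasiewicz property -/

/-- `ψ` is a desingularizing function on `[0, a)`, where `a ∈ (0, +∞]`. -/
structure IsDesingularizing (a : ℝ≥0∞) (ψ : ℝ → ℝ) : Prop where
  pos : 0 < a
  zero : ψ 0 = 0
  continuousOn : ContinuousOn ψ {s | 0 ≤ s ∧ ENNReal.ofReal s < a}
  concaveOn : ConcaveOn ℝ {s | 0 ≤ s ∧ ENNReal.ofReal s < a} ψ
  differentiableAt : ∀ s, 0 < s → ENNReal.ofReal s < a → DifferentiableAt ℝ ψ s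
  continuousOn_deriv : ContinuousOn (deriv ψ) {s | 0 < s ∧ ENNReal.ofReal s < a}
  deriv_pos : ∀ s, 0 < s → ENNReal.ofReal s < a → 0 < deriv ψ s

/-- The KL inequality holds around `xbar` with the desingularizing function `ψ`:
`ψ'(h x - h xbar) * dist (0, ∂h x) ≥ 1` for all `x` near `xbar` with
`h xbar < h x < h xbar + a`. The distance to the empty set is `+∞`. -/
def KLAtWith {V : Type*} [NormedAddCommGroup V] [InnerProductSpace ℝ V]
    (h : V → ℝ) (xbar : V) (ψ : ℝ → ℝ) : Prop :=
  ∃ a : ℝ≥0∞, IsDesingularizing a ψ ∧ ∃ O ∈ 𝓝 xbar, ∀ x ∈ O, h xbar < h x →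
    ENNReal.ofReal (h x - h xbar) < a →
      1 ≤ ENNReal.ofReal (deriv ψ (h x - h xbar)) * Metric.infEDist 0 (limitingSubdiff h x)

/-- `h` is a KL function with exponent `θ`: it is closed, and at every point of `dom ∂h` the KL
property holds with `ψ s = c * s ^ (1 - θ)` for some `c > 0`. -/
def IsKLFunctionWithExponent {V : Type*} [NormedAddCommGroup V] [InnerProductSpace ℝ V]
    (h : V → ℝ) (θ : ℝ) : Prop :=
  LowerSemicontinuous h ∧
    ∀ xbar, (limitingSubdiff h xbar).Nonempty →
      ∃ c : ℝ, 0 < c ∧ KLAtWith h xbar (fun s => c * s ^ (1 - θ))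

/-! ### The truncated quadratic models -/

/-- The isotropic and the anisotropic truncated quadratic model. -/
inductive TQKind
  | iso
  | aniso

/-- Data of a truncated quadratic model on real images over a finite set `Ω` of pixels:
the operator `A` and the observation `u₀`, the two components `D 0`, `D 1` of the discrete gradient
(any linear operators, so every discretization and boundary condition is allowed), and the
parameters `μ, lam > 0`. -/
structure TQModel (Ω Y : Type*) [Fintype Ω] [NormedAddCommGroup Y] [InnerProductSpace ℝ Y] where
  A : EuclideanSpace ℝ Ω →L[ℝ] Y
  u₀ : Y
  D : Fin 2 → EuclideanSpace ℝ Ω →ₗ[ℝ] EuclideanSpace ℝ Ω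
  μ : ℝ
  lam : ℝ
  μ_pos : 0 < μ
  lam_pos : 0 < lam

namespace TQModel

variable {Ω Y : Type*} [Fintype Ω] [NormedAddCommGroup Y] [InnerProductSpace ℝ Y]

/-- The data term `f u = ‖A u - u₀‖² / 2`. -/
def f (m : TQModel Ω Y) (u : EuclideanSpace ℝ Ω) : ℝ :=
  ‖m.A u - m.u₀‖ ^ 2 / 2

/-- The squared length `|∇u|²` of the discrete gradient at the pixel `p`. -/
def gradSq (m : TQModel Ω Y) (u : EuclideanSpace ℝ Ω) (p : Ω) : ℝ :=
  ∑ l, (m.D l u p) ^ 2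

/-- The truncated quadratic regularization `P`, summed over the pixels. -/
def P (m : TQModel Ω Y) : TQKind → EuclideanSpace ℝ Ω → ℝ
  | .iso, u => m.μ / 2 * ∑ p, min (m.gradSq u p) (m.lam / m.μ)
  | .aniso, u => m.μ / 2 * ∑ l, ∑ p, min ((m.D l u p) ^ 2) (m.lam / m.μ)

/-- The first convex part in `P = P₁ - P₂`. -/
def P₁ (m : TQModel Ω Y) : TQKind → EuclideanSpace ℝ Ω → ℝ
  | .iso, u => m.μ / 2 * ∑ p, (m.gradSq u p + m.lam / m.μ)
  | .aniso, u => m.μ / 2 * ∑ l, ∑ p, ((m.D l u p) ^ 2 + m.lam / m.μ)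

/-- The second convex part in `P = P₁ - P₂`. -/
def P₂ (m : TQModel Ω Y) : TQKind → EuclideanSpace ℝ Ω → ℝ
  | .iso, u => m.μ / 2 * ∑ p, max (m.gradSq u p) (m.lam / m.μ)
  | .aniso, u => m.μ / 2 * ∑ l, ∑ p, max ((m.D l u p) ^ 2) (m.lam / m.μ)

/-- The objective `F = f + P`. -/
def F (m : TQModel Ω Y) (k : TQKind) (u : EuclideanSpace ℝ Ω) : ℝ :=
  m.f u + m.P k u

/-- The decomposition on which the algorithm is based. -/
theorem P_eq_sub (m : TQModel Ω Y) (k : TQKind) (u : EuclideanSpace ℝ Ω) :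
    m.P k u = m.P₁ k u - m.P₂ k u := by
  have key : ∀ a b : ℝ, min a b = (a + b) - max a b := fun a b => by
    linarith [min_add_max a b]
  cases k <;> simp only [P, P₁, P₂, key, Finset.sum_sub_distrib, mul_sub]

end TQModel

/-- `‖u‖_M² = ⟨u, M u⟩`. -/
def sqNormM {V : Type*} [NormedAddCommGroup V] [InnerProductSpace ℝ V]
    (M : V →ₗ[ℝ] V) (u : V) : ℝ :=
  ⟪u, M u⟫

/-- `M` is self-adjoint and positive definite. -/
structure IsMetricOp {V : Type*} [NormedAddCommGroup V] [InnerProductSpace ℝ V]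
    (M : V →ₗ[ℝ] V) : Prop where
  symm : M.IsSymmetric
  pos : ∀ u, u ≠ 0 → 0 < ⟪u, M u⟫

/-- The auxiliary function `E (x, y) = F x + ‖x - y‖_M² / 2` on the product `X × X` with its
Euclidean (`ℓ²`) structure. -/
def TQModel.E {Ω Y : Type*} [Fintype Ω] [NormedAddCommGroup Y] [InnerProductSpace ℝ Y]
    (m : TQModel Ω Y) (k : TQKind) (M : EuclideanSpace ℝ Ω →ₗ[ℝ] EuclideanSpace ℝ Ω)
    (z : WithLp 2 (EuclideanSpace ℝ Ω × EuclideanSpace ℝ Ω)) : ℝ :=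
  m.F k z.fst + sqNormM M (z.fst - z.snd) / 2

/-- `F` is level-bounded: all its sublevel sets are bounded. -/
def LevelBounded {V : Type*} [NormedAddCommGroup V] (F : V → ℝ) : Prop :=
  ∀ α : ℝ, Bornology.IsBounded {u | F u ≤ α}

/-- The sequences `x, y, ξ` are generated by the preconditioned difference-of-convex algorithm with
extrapolation, with metric `M` and extrapolation parameters `β`. The convention `x⁻¹ = x⁰` is
expressed by the truncated subtraction `0 - 1 = 0` on natural numbers. -/
structure IsPreDCAe {Ω Y : Type*} [Fintype Ω] [NormedAddCommGroup Y] [InnerProductSpace ℝ Y]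
    (m : TQModel Ω Y) (k : TQKind) (M : EuclideanSpace ℝ Ω →ₗ[ℝ] EuclideanSpace ℝ Ω)
    (β : ℕ → ℝ) (x y ξ : ℕ → EuclideanSpace ℝ Ω) : Prop where
  β_mem : ∀ t, β t ∈ Set.Ico (0 : ℝ) 1
  β_sup : (⨆ t, β t) < 1
  ξ_mem : ∀ t, ξ t ∈ convexSubdiff (m.P₂ k) (x t)
  y_eq : ∀ t, y t = x t + β t • (x t - x (t - 1))
  x_argmin : ∀ t, IsMinOn
    (fun z => ⟪gradient m.f (y t) - ξ t, z⟫ + sqNormM M (z - y t) / 2 + m.P₁ k z)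
    Set.univ (x (t + 1))

end

open Set

/-! ### Quadratic expansions and truncated squares. -/

section Quadratics

variable {V W ι : Type*} [NormedAddCommGroup V] [InnerProductSpace ℝ V]
  [NormedAddCommGroup W] [InnerProductSpace ℝ W] [Fintype ι]

/-! Both models are covered by one family of linear maps `B i`: `P₁` and `P₂` are weighted sums of
`‖B i u‖² + τ` and `max (‖B i u‖²) τ`.

Near the limit `a`, every subgradient of `P₂` at `x` satisfies a reverse subgradient inequality
whose quadratic error is cancelled exactly by the curvature of `P₁`. What remains is the curvature
of `f`, which is positive definite: `P` is bounded, so level-boundedness forces `A` to be injective.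
Hence `F x - F a + κ/2 ‖x - a‖²` is at most the first-order residual paired with `x - a`
(`eventually_F_sub_le`), also at kinks.

Along the iterates, the residual is bounded by two consecutive steps (`exists_residual_le`), and the
energy gap `h t = F (x t) + ‖x t - x (t-1)‖_M²/2 - F a` decreases by a multiple of a squared step
(`F_add_le_of_step`). Young's inequality combines these into `h t + κ/4 ‖x t - a‖² ≤ K (h t - h
(t+2))`, which makes `h` decay geometrically and carries the error with it. -/

/-- Near `a`, the one-sided growth of `max (‖B ·‖²) τ` at `x` in the direction `x - a` is
controlled by its values at `x` and `a`. -/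
theorem eventually_max_norm_sq_le (B : V →L[ℝ] W) (τ : ℝ) (a : V) :
    ∀ᶠ x in 𝓝 a, ∀ᶠ ε in 𝓝[>] (0 : ℝ), max (‖B (x + ε • (x - a))‖ ^ 2) τ ≤
      max (‖B x‖ ^ 2) τ +
        (ε * (max (‖B x‖ ^ 2) τ - max (‖B a‖ ^ 2) τ + ‖B (x - a)‖ ^ 2) +
          ε ^ 2 * ‖B (x - a)‖ ^ 2) := by
  have hc : Continuous fun x => ‖B x‖ ^ 2 := by fun_prop
  have h₁ : ∀ᶠ x in 𝓝 a, τ < ‖B a‖ ^ 2 → τ < ‖B x‖ ^ 2 := by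
    by_cases h : τ < ‖B a‖ ^ 2
    · filter_upwards [hc.continuousAt.eventually_const_lt h] with x hx _ using hx
    · exact Eventually.of_forall fun x hx => absurd hx h
  have h₂ : ∀ᶠ x in 𝓝 a, ‖B a‖ ^ 2 < τ → ‖B x‖ ^ 2 < τ := by
    by_cases h : ‖B a‖ ^ 2 < τ
    · filter_upwards [hc.continuousAt.eventually_lt_const h] with x hx _ using hx
    · exact Eventually.of_forall fun x hx => absurd hx h
  filter_upwards [h₁, h₂] with x hx₁ hx₂
  have hexp : ∀ ε : ℝ, ‖B (x + ε • (x - a))‖ ^ 2 =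
      ‖B x‖ ^ 2 + 2 * ε * ⟪B x, B (x - a)⟫ + ε ^ 2 * ‖B (x - a)‖ ^ 2 := fun ε => by
    rw [map_add, map_smul, norm_add_sq_real, real_inner_smul_right, norm_smul, mul_pow,
      Real.norm_eq_abs, sq_abs]
    ring
  have ha : ‖B a‖ ^ 2 = ‖B x‖ ^ 2 - 2 * ⟪B x, B (x - a)⟫ + ‖B (x - a)‖ ^ 2 := by
    -- At `ε = -1` the ray passes through `a`, so the slope at `x` is determined by the values at
    -- `x` and `a`.
    have := hexp (-1)
    rw [neg_one_smul, neg_sub, add_sub_cancel] at this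
    rw [this]
    ring
  have hcε : ContinuousAt (fun ε : ℝ => ‖B (x + ε • (x - a))‖ ^ 2) 0 := by fun_prop
  have h0 : ‖B (x + (0 : ℝ) • (x - a))‖ ^ 2 = ‖B x‖ ^ 2 := by simp
  have hpos := sq_nonneg ‖B (x - a)‖
  rcases lt_trichotomy (‖B x‖ ^ 2) τ with h | h | h
  · have hle : ‖B a‖ ^ 2 ≤ τ := not_lt.1 fun h' => (hx₁ h').not_gt h
    have := hcε.eventually_lt_const (by simpa only [h0] using h)
    filter_upwards [this.filter_mono nhdsWithin_le_nhds, self_mem_nhdsWithin] with ε hε hε0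
    rw [max_eq_right hε.le, max_eq_right h.le, max_eq_right hle]
    have : 0 < ε := hε0
    rw [sub_self, zero_add]
    have : 0 ≤ ε * ‖B (x - a)‖ ^ 2 + ε ^ 2 * ‖B (x - a)‖ ^ 2 := by positivity
    linarith
  -- If `x` lies on the kink, then so does `a`, as strict inequalities at `a` persist nearby; the
  -- increment of the quadratic branch is then exactly the allowed error.
  · have hle : ‖B a‖ ^ 2 = τ :=
      le_antisymm (not_lt.1 fun h' => (hx₁ h').ne' h) (not_lt.1 fun h' => (hx₂ h').ne h)
    filter_upwards [self_mem_nhdsWithin] with ε hε0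
    have : 0 < ε := hε0
    have h2 : 2 * ⟪B x, B (x - a)⟫ = ‖B (x - a)‖ ^ 2 := by linarith
    have h3 : 0 ≤ ε * ‖B (x - a)‖ ^ 2 + ε ^ 2 * ‖B (x - a)‖ ^ 2 := by positivity
    rw [h, hle, max_self, sub_self, zero_add]
    refine max_le ?_ (by linarith)
    rw [hexp, h, ← h2]
    linarith
  · have hle : τ ≤ ‖B a‖ ^ 2 := not_lt.1 fun h' => (hx₂ h').not_gt h
    have := hcε.eventually_const_lt (by simpa only [h0] using h)
    filter_upwards [this.filter_mono nhdsWithin_le_nhds] with ε hε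
    rw [max_eq_left hε.le, max_eq_left h.le, max_eq_left hle, hexp, ha]
    linarith

/-- A weighted sum of truncations from below of squared seminorms satisfies a reverse subgradient
inequality, up to a quadratic term, between a point and all points close to it. -/
theorem eventually_reverse_subgradient (B : ι → V →L[ℝ] W) (c τ : ℝ) (hc : 0 ≤ c) (a : V)
    (g : V → ℝ) (hg : ∀ u, g u = c * ∑ i, max (‖B i u‖ ^ 2) τ) :
    ∀ᶠ x in 𝓝 a, ∀ ξ ∈ convexSubdiff g x,
      g a - g x ≤ -⟪ξ, x - a⟫ + c * ∑ i, ‖B i (x - a)‖ ^ 2 := by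
  have := eventually_all.2 fun i => eventually_max_norm_sq_le (B i) τ a
  filter_upwards [this] with x hx ξ hξ
  set S := c * ∑ i, ‖B i (x - a)‖ ^ 2 with hS
  have hev : ∀ᶠ ε in 𝓝[>] (0 : ℝ), ⟪ξ, x - a⟫ ≤ g x - g a + S + ε * S := by
    filter_upwards [eventually_all.2 hx, self_mem_nhdsWithin] with ε hε hε0
    have hε0 : 0 < ε := hε0
    -- Testing `ξ` beyond `x`, away from `a`, bounds `⟪ξ, x - a⟫` from above; testing at `a` itself
    -- would only bound it from below.
    have h1 := hξ (x + ε • (x - a))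
    rw [add_sub_cancel_left, real_inner_smul_right] at h1
    have h2 : g (x + ε • (x - a)) ≤ g x + (ε * (g x - g a + S) + ε ^ 2 * S) := by
      have := mul_le_mul_of_nonneg_left (Finset.sum_le_sum fun i (_ : i ∈ Finset.univ) => hε i) hc
      rw [← hg] at this
      refine this.trans_eq ?_
      simp only [hg, hS, Finset.sum_add_distrib, ← Finset.mul_sum, Finset.sum_sub_distrib]
      ring
    have h3 : ε * ⟪ξ, x - a⟫ ≤ ε * (g x - g a + S + ε * S) := by linarith
    exact le_of_mul_le_mul_left h3 hε0
  have hlim : Tendsto (fun ε : ℝ => g x - g a + S + ε * S) (𝓝[>] 0) (𝓝 (g x - g a + S + 0 * S)) :=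
    (Continuous.tendsto (by fun_prop) 0).mono_left nhdsWithin_le_nhds
  have := ge_of_tendsto hlim hev
  linarith

/-- A real quadratic polynomial without constant term that is nonnegative has no linear term. -/
theorem eq_zero_of_forall_mul_add_sq_nonneg {a b : ℝ} (h : ∀ ε : ℝ, 0 ≤ ε * a + ε ^ 2 * b) :
    a = 0 := by
  have hd : HasDerivAt (fun ε : ℝ => ε * a + ε ^ 2 * b) a 0 := by
    simpa using ((hasDerivAt_id' (0 : ℝ)).mul_const a).fun_add ((hasDerivAt_pow 2 (0 : ℝ)).mul_const b)
  refine IsLocalMin.hasDerivAt_eq_zero (Eventually.of_forall fun ε => ?_) hd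
  simpa using h ε

theorem sum_norm_sq_add (B : ι → V →L[ℝ] W) (x v : V) :
    ∑ i, ‖B i (x + v)‖ ^ 2 =
      ∑ i, ‖B i x‖ ^ 2 + 2 * ∑ i, ⟪B i x, B i v⟫ + ∑ i, ‖B i v‖ ^ 2 := by
  simp only [map_add, norm_add_sq_real, Finset.sum_add_distrib, Finset.mul_sum]

theorem sqNormM_add {M : V →ₗ[ℝ] V} (hM : M.IsSymmetric) (x v : V) :
    sqNormM M (x + v) = sqNormM M x + 2 * ⟪M x, v⟫ + sqNormM M v := by
  have h1 : ⟪x, M v⟫ = ⟪M x, v⟫ := (hM x v).symm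
  have h2 : ⟪v, M x⟫ = ⟪M x, v⟫ := real_inner_comm _ _
  simp only [sqNormM, map_add, inner_add_left, inner_add_right, h1, h2]
  ring

theorem sqNormM_smul (M : V →ₗ[ℝ] V) (c : ℝ) (x : V) :
    sqNormM M (c • x) = c ^ 2 * sqNormM M x := by
  simp only [sqNormM, map_smul, real_inner_smul_left, real_inner_smul_right]
  ring

/-- The first order condition for the subproblem of the algorithm. -/
theorem optimality_of_isMinOn {M : V →ₗ[ℝ] V} (hM : M.IsSymmetric) (B : ι → V →L[ℝ] W)
    (c τ : ℝ) (g w y : V) (h : IsMinOn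
      (fun z => ⟪g, z⟫ + sqNormM M (z - y) / 2 + c / 2 * ∑ i, (‖B i z‖ ^ 2 + τ)) univ w) (v : V) :
    ⟪g, v⟫ + ⟪M (w - y), v⟫ + c * ∑ i, ⟪B i w, B i v⟫ = 0 := by
  refine eq_zero_of_forall_mul_add_sq_nonneg
    (b := sqNormM M v / 2 + c / 2 * ∑ i, ‖B i v‖ ^ 2) fun ε => ?_
  have := h (mem_univ (w + ε • v))
  simp only [mem_ofPred_eq, add_sub_right_comm, sqNormM_add hM, sqNormM_smul,
    Finset.sum_add_distrib, sum_norm_sq_add, inner_add_right, real_inner_smul_right, map_smul,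
    norm_smul, mul_pow, Real.norm_eq_abs, sq_abs, ← Finset.mul_sum] at this
  linarith

end Quadratics

/-! ### The data term and its coercivity. -/

namespace TQModel

variable {Ω Y : Type*} [Fintype Ω] [NormedAddCommGroup Y] [InnerProductSpace ℝ Y]

theorem inner_gradient_f (m : TQModel Ω Y) (u v : EuclideanSpace ℝ Ω) :
    ⟪gradient m.f u, v⟫ = ⟪m.A u - m.u₀, m.A v⟫ := by
  have h1 : HasFDerivAt (fun u => m.A u - m.u₀) m.A u := m.A.hasFDerivAt.sub_const _
  have h2 : HasFDerivAt m.f ((2 : ℝ)⁻¹ • (2 • (innerSL ℝ (m.A u - m.u₀)).comp m.A)) u := by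
    have := h1.norm_sq.const_mul (2 : ℝ)⁻¹
    refine this.congr_of_eventuallyEq (Eventually.of_forall fun z => ?_)
    simp only [f]
    ring
  rw [gradient, InnerProductSpace.toDual_symm_apply, h2.fderiv]
  simp [inner_sub_left]

theorem f_add (m : TQModel Ω Y) (u v : EuclideanSpace ℝ Ω) :
    m.f (u + v) = m.f u + ⟪gradient m.f u, v⟫ + ‖m.A v‖ ^ 2 / 2 := by
  rw [inner_gradient_f, f, f, map_add, add_sub_right_comm, norm_add_sq_real]
  ring

/-- The gradient is affine, with `⟪∇f v - ∇f 0, v⟫ = ‖A v‖²`. Together with `M ≥ L I` this lets the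
metric dominate the curvature of `f`. -/
theorem norm_sq_A_le (m : TQModel Ω Y) {L : ℝ≥0} (hL : LipschitzWith L (gradient m.f))
    (v : EuclideanSpace ℝ Ω) : ‖m.A v‖ ^ 2 ≤ L * ‖v‖ ^ 2 := by
  have h : ⟪gradient m.f v - gradient m.f 0, v⟫ = ‖m.A v‖ ^ 2 := by
    rw [inner_sub_left, inner_gradient_f, inner_gradient_f, ← inner_sub_left]
    simp
  rw [← h, pow_two, ← mul_assoc]
  refine (real_inner_le_norm _ _).trans (mul_le_mul_of_nonneg_right ?_ (norm_nonneg _))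
  simpa using hL.norm_sub_le v 0

theorem P_le (m : TQModel Ω Y) (k : TQKind) : ∃ C, ∀ u, m.P k u ≤ C := by
  have hμ := m.μ_pos
  cases k
  · exact ⟨m.μ / 2 * ∑ _p : Ω, m.lam / m.μ, fun u => mul_le_mul_of_nonneg_left
      (Finset.sum_le_sum fun _ _ => min_le_right _ _) (by positivity)⟩
  · exact ⟨m.μ / 2 * ∑ _l : Fin 2, ∑ _p : Ω, m.lam / m.μ, fun u => mul_le_mul_of_nonneg_left
      (Finset.sum_le_sum fun _ _ => Finset.sum_le_sum fun _ _ => min_le_right _ _) (by positivity)⟩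

/-- As the regularization is bounded, level-boundedness of `F` makes the data term coercive. -/
theorem exists_mul_norm_sq_le_of_levelBounded (m : TQModel Ω Y) (k : TQKind)
    (hF : LevelBounded (m.F k)) : ∃ κ : ℝ, 0 < κ ∧ ∀ u, κ * ‖u‖ ^ 2 ≤ ‖m.A u‖ ^ 2 := by
  have hker : m.A.toLinearMap.ker = ⊥ := by
    rw [LinearMap.ker_eq_bot']
    intro u hu
    have hu : m.A u = 0 := hu
    by_contra hne
    obtain ⟨C, hC⟩ := m.P_le k
    obtain ⟨R, hR⟩ := (hF (‖m.u₀‖ ^ 2 / 2 + C)).exists_norm_le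
    obtain ⟨n, hn⟩ := exists_nat_gt (R / ‖u‖)
    -- On a line spanned by a kernel vector `f` is constant and `P` is bounded, so a sublevel set
    -- contains the whole line.
    have hmem : (n : ℝ) • u ∈ {v | m.F k v ≤ ‖m.u₀‖ ^ 2 / 2 + C} := by
      have : m.f ((n : ℝ) • u) = ‖m.u₀‖ ^ 2 / 2 := by simp [f, hu]
      simpa [F, this] using hC _
    have := hR _ hmem
    rw [norm_smul, Real.norm_natCast] at this
    rw [div_lt_iff₀ (norm_pos_iff.2 hne)] at hn
    linarith
  obtain ⟨K, hK, hA⟩ := m.A.toLinearMap.exists_antilipschitzWith hker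
  have hK : (0 : ℝ) < K := hK
  refine ⟨((K : ℝ) ^ 2)⁻¹, by positivity, fun u => ?_⟩
  have h : ‖u‖ ≤ K * ‖m.A u‖ := by simpa using hA.le_mul_dist u 0
  rw [inv_mul_le_iff₀ (by positivity), ← mul_pow]
  exact pow_le_pow_left₀ (norm_nonneg _) h 2

end TQModel

/-- A nonnegative antitone sequence that contracts by the factor `ρ` in every two steps is bounded
by a geometric sequence. -/
theorem exists_geometric_bound {h : ℕ → ℝ} {T : ℕ} {ρ : ℝ} (hρ : 0 < ρ)
    (hanti : ∀ t, T ≤ t → h (t + 1) ≤ h t) (hcontr : ∀ t, T ≤ t → h (t + 2) ≤ ρ ^ 4 * h t)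
    (hρ1 : ρ ≤ 1) : ∃ C : ℝ, 0 < C ∧ ∀ t, T ≤ t → h t ≤ C * (ρ ^ t) ^ 2 := by
  obtain ⟨C, hC, hCT⟩ : ∃ C : ℝ, 0 < C ∧ h T ≤ C * (ρ ^ (T + 1)) ^ 2 := by
    -- The exponent `T + 1` lets this one constant serve both base cases, `T` and `T + 1`, of the
    -- two-step induction.
    refine ⟨(|h T| + 1) / (ρ ^ (T + 1)) ^ 2, by positivity, ?_⟩
    rw [div_mul_cancel₀ _ (by positivity)]
    linarith [le_abs_self (h T)]
  have key : ∀ n, h (T + n) ≤ C * (ρ ^ (T + n)) ^ 2 ∧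
      h (T + n + 1) ≤ C * (ρ ^ (T + n + 1)) ^ 2 := by
    intro n
    induction n with
    | zero =>
      refine ⟨hCT.trans ?_, (hanti T le_rfl).trans hCT⟩
      have : ρ ^ (T + 1) ≤ ρ ^ (T + 0) := pow_le_pow_of_le_one hρ.le hρ1 (Nat.le_succ _)
      gcongr
    | succ n ih =>
      refine ⟨ih.2, (hcontr (T + n) (Nat.le_add_right _ _)).trans ?_⟩
      calc ρ ^ 4 * h (T + n) ≤ ρ ^ 4 * (C * (ρ ^ (T + n)) ^ 2) := by gcongr; exact ih.1
        _ = C * (ρ ^ (T + (n + 1) + 1)) ^ 2 := by ring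
  refine ⟨C, hC, fun t ht => ?_⟩
  obtain ⟨n, rfl⟩ := Nat.exists_eq_add_of_le ht
  exact (key n).1

/-! ### Descent, residual and linear convergence of the iterates. -/

namespace TQModel

variable {Ω Y W ι : Type*} [Fintype Ω] [NormedAddCommGroup Y] [InnerProductSpace ℝ Y]
  [NormedAddCommGroup W] [InnerProductSpace ℝ W] [Fintype ι]

theorem continuous_F (m : TQModel Ω Y) (k : TQKind) : Continuous (m.F k) := by
  have hD : ∀ l p, Continuous fun u => m.D l u p := fun l p =>
    (continuous_apply p).comp ((PiLp.continuous_ofLp 2 _).comp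
      (m.D l).continuous_of_finiteDimensional)
  have hf : Continuous m.f := by unfold f; fun_prop
  have hP : Continuous fun u => m.P k u := by
    cases k <;> simp only [P, gradSq] <;> fun_prop
  exact hf.add hP

/-- One step of the algorithm decreases the objective up to the extrapolation term. -/
theorem F_add_le_of_step (m : TQModel Ω Y) (k : TQKind) (B : ι → EuclideanSpace ℝ Ω →L[ℝ] W)
    (hP₁ : ∀ u, m.P₁ k u = m.μ / 2 * ∑ i, (‖B i u‖ ^ 2 + m.lam / m.μ))
    {M : EuclideanSpace ℝ Ω →ₗ[ℝ] EuclideanSpace ℝ Ω} (hM : M.IsSymmetric)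
    (hAM : ∀ u, ‖m.A u‖ ^ 2 ≤ sqNormM M u) {w x y ξ : EuclideanSpace ℝ Ω}
    (hξ : ξ ∈ convexSubdiff (m.P₂ k) x)
    (hopt : ∀ v, ⟪gradient m.f y - ξ, v⟫ + ⟪M (w - y), v⟫ +
      m.μ * ∑ i, ⟪B i w, B i v⟫ = 0) :
    m.F k w + sqNormM M (w - x) / 2 ≤ m.F k x + sqNormM M (x - y) / 2 := by
  have hμ := m.μ_pos
  have e1 := m.f_add y (w - y)
  have e2 := m.f_add y (x - y)
  have e3 := hξ w
  have e4 := hopt (x - w)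
  have e5 := sqNormM_add hM (w - y) (x - w)
  have e6 := sum_norm_sq_add B w (x - w)
  have e7 := hAM (w - y)
  have e8 : sqNormM M (x - w) = sqNormM M (w - x) := by
    rw [← neg_sub, ← neg_one_smul ℝ, sqNormM_smul]
    ring
  have e9 : 0 ≤ m.μ * ∑ i, ‖B i (x - w)‖ ^ 2 := by positivity
  rw [show w - y + (x - w) = x - y by abel] at e5
  rw [add_sub_cancel] at e1 e2 e6
  have e10 : ⟪gradient m.f y, x - w⟫ = ⟪gradient m.f y, x - y⟫ - ⟪gradient m.f y, w - y⟫ := by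
    rw [← inner_sub_right]
    congr 1
    abel
  have e11 : ⟪ξ, w - x⟫ = -⟪ξ, x - w⟫ := by rw [← inner_neg_right, neg_sub]
  rw [inner_sub_left, e10] at e4
  have e12 := sq_nonneg ‖m.A (x - y)‖
  simp only [F, P_eq_sub, hP₁, Finset.sum_add_distrib, e6]
  rw [e8] at e5
  linarith

/-- Points close to `a` satisfy a strong monotonicity inequality with respect to `a`. -/
theorem eventually_F_sub_le (m : TQModel Ω Y) (k : TQKind) (B : ι → EuclideanSpace ℝ Ω →L[ℝ] W)
    (hP₁ : ∀ u, m.P₁ k u = m.μ / 2 * ∑ i, (‖B i u‖ ^ 2 + m.lam / m.μ))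
    (hP₂ : ∀ u, m.P₂ k u = m.μ / 2 * ∑ i, max (‖B i u‖ ^ 2) (m.lam / m.μ))
    (a : EuclideanSpace ℝ Ω) : ∀ᶠ x in 𝓝 a, ∀ ξ ∈ convexSubdiff (m.P₂ k) x,
      m.F k x - m.F k a + ‖m.A (x - a)‖ ^ 2 / 2 ≤
        ⟪gradient m.f x - ξ, x - a⟫ + m.μ * ∑ i, ⟪B i x, B i (x - a)⟫ := by
  filter_upwards [eventually_reverse_subgradient B (m.μ / 2) (m.lam / m.μ) (half_pos m.μ_pos).le
    a (m.P₂ k) hP₂] with x hx ξ hξ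
  have e1 := hx ξ hξ
  have e2 := m.f_add x (-(x - a))
  have e3 := sum_norm_sq_add B x (-(x - a))
  simp only [show x + -(x - a) = a by abel, map_neg, norm_neg, inner_neg_right,
    Finset.sum_neg_distrib] at e2 e3
  simp only [F, P_eq_sub, hP₁, Finset.sum_add_distrib, e2, e3, inner_sub_left]
  linarith

/-- The residual of the optimality condition is controlled by two consecutive steps. -/
theorem exists_residual_le (m : TQModel Ω Y) (B : ι → EuclideanSpace ℝ Ω →L[ℝ] W)
    {L : ℝ≥0} (hL : LipschitzWith L (gradient m.f))
    (M : EuclideanSpace ℝ Ω →ₗ[ℝ] EuclideanSpace ℝ Ω) :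
    ∃ C : ℝ, 0 ≤ C ∧ ∀ w x y ξ e : EuclideanSpace ℝ Ω,
      (∀ v, ⟪gradient m.f y - ξ, v⟫ + ⟪M (w - y), v⟫ + m.μ * ∑ i, ⟪B i w, B i v⟫ = 0) →
      ⟪gradient m.f x - ξ, e⟫ + m.μ * ∑ i, ⟪B i x, B i e⟫ ≤
        C * (‖w - x‖ + ‖x - y‖) * ‖e‖ := by
  have hμ := m.μ_pos
  set N := ‖LinearMap.toContinuousLinearMap M‖
  set S := ∑ i, ‖B i‖ ^ 2
  refine ⟨L + N + m.μ * S, by positivity, fun w x y ξ e h => ?_⟩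
  have h1 : ⟪gradient m.f x - gradient m.f y, e⟫ ≤ L * ‖x - y‖ * ‖e‖ :=
    (real_inner_le_norm _ _).trans
      (mul_le_mul_of_nonneg_right (hL.norm_sub_le x y) (norm_nonneg _))
  have h2 : -⟪M (w - y), e⟫ ≤ N * (‖w - x‖ + ‖x - y‖) * ‖e‖ := by
    rw [← inner_neg_left]
    refine (real_inner_le_norm _ _).trans (mul_le_mul_of_nonneg_right ?_ (norm_nonneg _))
    rw [norm_neg]
    refine ((LinearMap.toContinuousLinearMap M).le_opNorm (w - y)).trans ?_
    gcongr
    exact norm_sub_le_norm_sub_add_norm_sub _ _ _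
  have h3 : ∑ i, ⟪B i (x - w), B i e⟫ ≤ S * ‖w - x‖ * ‖e‖ := by
    rw [Finset.sum_mul, Finset.sum_mul]
    refine Finset.sum_le_sum fun i _ => (real_inner_le_norm _ _).trans ?_
    calc ‖B i (x - w)‖ * ‖B i e‖ ≤ (‖B i‖ * ‖x - w‖) * (‖B i‖ * ‖e‖) :=
          mul_le_mul ((B i).le_opNorm _) ((B i).le_opNorm _) (norm_nonneg _) (by positivity)
      _ = ‖B i‖ ^ 2 * ‖w - x‖ * ‖e‖ := by rw [norm_sub_rev]; ring
  have h4 := h e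
  have h5 : ∑ i, ⟪B i (x - w), B i e⟫ = ∑ i, ⟪B i x, B i e⟫ - ∑ i, ⟪B i w, B i e⟫ := by
    simp only [map_sub, inner_sub_left, Finset.sum_sub_distrib]
  have h6 := mul_le_mul_of_nonneg_left h3 hμ.le
  rw [h5] at h6
  rw [inner_sub_left] at h1 h4 ⊢
  have h7 : 0 ≤ L * ‖w - x‖ * ‖e‖ := by positivity
  have h8 : 0 ≤ m.μ * S * ‖x - y‖ * ‖e‖ := by positivity
  linarith

/-- Convergent iterates converge linearly. Level-boundedness forces `A` to be injective, so all
active quadratic pieces of the objective are uniformly strongly convex; this yields the growth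
condition with exponent `1 / 2` along the iterates directly, also at the kinks of `P₂`, where the
subgradients produced by the algorithm need not be limiting subgradients of the objective. -/
theorem linear_convergence (m : TQModel Ω Y) (k : TQKind) (hF : LevelBounded (m.F k))
    (B : ι → EuclideanSpace ℝ Ω →L[ℝ] W)
    (hP₁ : ∀ u, m.P₁ k u = m.μ / 2 * ∑ i, (‖B i u‖ ^ 2 + m.lam / m.μ))
    (hP₂ : ∀ u, m.P₂ k u = m.μ / 2 * ∑ i, max (‖B i u‖ ^ 2) (m.lam / m.μ))
    (L : ℝ≥0) (hL : LipschitzWith L (gradient m.f))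
    (M : EuclideanSpace ℝ Ω →ₗ[ℝ] EuclideanSpace ℝ Ω) (hM : M.IsSymmetric)
    (hML : ∀ u, (L : ℝ) * ‖u‖ ^ 2 ≤ sqNormM M u)
    (β : ℕ → ℝ) (x y ξ : ℕ → EuclideanSpace ℝ Ω) (hx : IsPreDCAe m k M β x y ξ)
    (a : EuclideanSpace ℝ Ω) (hlim : Tendsto x atTop (𝓝 a)) :
    ∃ c₁ : ℝ, 0 < c₁ ∧ ∃ t₀ : ℕ, 0 < t₀ ∧ ∃ η ∈ Ioo (0 : ℝ) 1,
      ∀ t, t₀ < t → ‖x t - a‖ < c₁ * η ^ t := by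
  obtain ⟨κ, hκ, hκA⟩ := m.exists_mul_norm_sq_le_of_levelBounded k hF
  have hAM : ∀ u, ‖m.A u‖ ^ 2 ≤ sqNormM M u := fun u => (m.norm_sq_A_le hL u).trans (hML u)
  obtain ⟨C, hC, hres⟩ := m.exists_residual_le B hL M
  have hopt : ∀ t v, ⟪gradient m.f (y t) - ξ t, v⟫ + ⟪M (x (t + 1) - y t), v⟫ +
      m.μ * ∑ i, ⟪B i (x (t + 1)), B i v⟫ = 0 := fun t v => by
    refine optimality_of_isMinOn hM B m.μ (m.lam / m.μ) _ _ _ ?_ v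
    simpa only [hP₁] using hx.x_argmin t
  have hxy : ∀ t, x t - y t = (-β t) • (x t - x (t - 1)) := fun t => by
    rw [hx.y_eq, neg_smul]
    abel
  set b := ⨆ t, β t with hb
  have hb1 : b < 1 := hx.β_sup
  have hβb : ∀ t, β t ≤ b :=
    le_ciSup ⟨1, by rintro _ ⟨t, rfl⟩; exact (hx.β_mem t).2.le⟩
  set d : ℕ → ℝ := fun t => sqNormM M (x t - x (t - 1)) / 2 with hd
  have hdκ : ∀ t, κ * ‖x t - x (t - 1)‖ ^ 2 ≤ 2 * d t := fun t => by
    have := (hκA _).trans (hAM (x t - x (t - 1)))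
    simp only [hd]
    linarith
  have hd0 : ∀ t, 0 ≤ d t := fun t => by
    have h1 := hdκ t
    have h2 : 0 ≤ κ * ‖x t - x (t - 1)‖ ^ 2 := by positivity
    linarith
  set h : ℕ → ℝ := fun t => m.F k (x t) + d t - m.F k a with hh
  have hstep : ∀ t, h (t + 1) ≤ h t - (1 - b) * d t := fun t => by
    have h1 := m.F_add_le_of_step k B hP₁ hM hAM (hx.ξ_mem t) (hopt t)
    rw [hxy, sqNormM_smul] at h1
    -- Since `0 ≤ β t < 1`, `β t ^ 2 ≤ β t ≤ b`.
    have h2 : (-β t) ^ 2 ≤ b := by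
      rw [neg_sq]
      nlinarith [hβb t, (hx.β_mem t).1, (hx.β_mem t).2]
    have h3 := mul_le_mul_of_nonneg_right h2 (hd0 t)
    simp only [hh, hd, add_tsub_cancel_right] at h3 ⊢
    linarith
  have hanti : Antitone h := antitone_nat_of_succ_le fun t => by
    have := hstep t
    have h2 := mul_nonneg (sub_nonneg.2 hb1.le) (hd0 t)
    linarith
  have hh0 : ∀ t, 0 ≤ h t := by
    have hd' : Tendsto d atTop (𝓝 0) := by
      have h1 : Tendsto (fun t => x t - x (t - 1)) atTop (𝓝 (a - a)) :=
        hlim.sub (hlim.comp (tendsto_sub_atTop_nat 1))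
      have h2 : Continuous fun u => sqNormM M u / 2 := by
        have := M.continuous_of_finiteDimensional
        unfold sqNormM
        fun_prop
      have h3 : Tendsto d atTop (𝓝 (sqNormM M (a - a) / 2)) := (h2.tendsto (a - a)).comp h1
      rwa [sub_self, sqNormM, inner_zero_left, zero_div] at h3
    have h1 := ((((m.continuous_F k).tendsto a).comp hlim).add hd').sub_const (m.F k a)
    rw [add_zero, sub_self] at h1
    exact fun t => hanti.le_of_tendsto h1 t
  obtain ⟨T, hT⟩ := eventually_atTop.1
    (hlim.eventually (m.eventually_F_sub_le k B hP₁ hP₂ a))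
  set r : ℕ → ℝ := fun t => C * (‖x (t + 1) - x t‖ + ‖x t - x (t - 1)‖) with hr
  have hkey : ∀ t, T ≤ t →
      m.F k (x t) - m.F k a + κ * ‖x t - a‖ ^ 2 / 2 ≤ r t * ‖x t - a‖ := fun t ht => by
    have h1 := hT t ht _ (hx.ξ_mem t)
    have h2 := hres _ (x t) _ _ (x t - a) (hopt t)
    have h3 := hκA (x t - a)
    have h4 : ‖x t - y t‖ ≤ ‖x t - x (t - 1)‖ := by
      rw [hxy, norm_smul, norm_neg, Real.norm_eq_abs, abs_of_nonneg (hx.β_mem t).1]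
      exact mul_le_of_le_one_left (norm_nonneg _) (hx.β_mem t).2.le
    have h5 : C * (‖x (t + 1) - x t‖ + ‖x t - y t‖) * ‖x t - a‖ ≤ r t * ‖x t - a‖ := by
      simp only [hr]
      gcongr
    linarith
  set c := 4 * C ^ 2 / κ with hc
  have hc0 : 0 ≤ c := by positivity
  have hr2 : ∀ t, r t ^ 2 ≤ c * (d t + d (t + 1)) := fun t => by
    have h1 := hdκ t
    have h2 := hdκ (t + 1)
    rw [add_tsub_cancel_right] at h2
    have h3 : r t ^ 2 ≤ 2 * C ^ 2 * (‖x (t + 1) - x t‖ ^ 2 + ‖x t - x (t - 1)‖ ^ 2) := by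
      simp only [hr, mul_pow]
      nlinarith [mul_nonneg (sq_nonneg C) (sq_nonneg (‖x (t + 1) - x t‖ - ‖x t - x (t - 1)‖))]
    have h4 : C ^ 2 * (κ * (‖x (t + 1) - x t‖ ^ 2 + ‖x t - x (t - 1)‖ ^ 2)) ≤
        C ^ 2 * (2 * (d t + d (t + 1))) :=
      mul_le_mul_of_nonneg_left (by linarith) (sq_nonneg C)
    rw [hc, div_mul_eq_mul_div, le_div_iff₀ hκ]
    have h5 := mul_le_mul_of_nonneg_right h3 hκ.le
    linarith
  have hyoung : ∀ t, r t * ‖x t - a‖ ≤ κ * ‖x t - a‖ ^ 2 / 4 + r t ^ 2 / κ := fun t => by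
    have h1 : κ * ‖x t - a‖ ^ 2 / 4 + r t ^ 2 / κ - r t * ‖x t - a‖ =
        (κ * ‖x t - a‖ / 2 - r t) ^ 2 / κ := by
      field_simp
      ring
    have h2 : 0 ≤ (κ * ‖x t - a‖ / 2 - r t) ^ 2 / κ := by positivity
    linarith
  -- The summand `1` ensures `K > 1`, so that the contraction factor `1 - K⁻¹` is positive.
  set K := (1 + c / κ) / (1 - b) + 1 with hK
  have hb0 : 0 < 1 - b := sub_pos.2 hb1
  have hK1 : 1 < K := by
    have : 0 < (1 + c / κ) / (1 - b) := by positivity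
    linarith
  have hdd : ∀ t, (1 + c / κ) * (d t + d (t + 1)) ≤ K * (h t - h (t + 2)) := fun t => by
    have h1 := hstep t
    have h2 := hstep (t + 1)
    have h3 : (1 - b) * (d t + d (t + 1)) ≤ h t - h (t + 2) := by linarith
    have h4 : 0 ≤ h t - h (t + 2) := sub_nonneg.2 (hanti (by lia))
    have h5 : (1 + c / κ) * (d t + d (t + 1)) =
        (1 + c / κ) / (1 - b) * ((1 - b) * (d t + d (t + 1))) := by
      field_simp
    have h6 : 0 ≤ (1 + c / κ) / (1 - b) := by positivity
    have h7 := mul_le_mul_of_nonneg_left h3 h6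
    rw [h5, hK]
    linarith
  have hboth : ∀ t, T ≤ t → h t + κ * ‖x t - a‖ ^ 2 / 4 ≤ K * (h t - h (t + 2)) := fun t ht => by
    have h1 := hkey t ht
    have h2 := hyoung t
    have h3 : r t ^ 2 / κ ≤ c / κ * (d t + d (t + 1)) := by
      rw [div_mul_eq_mul_div]
      exact div_le_div_of_nonneg_right (hr2 t) hκ.le
    have h4 := hdd t
    have h5 := hd0 (t + 1)
    simp only [hh] at h4 ⊢
    linarith
  set q := 1 - K⁻¹ with hq
  have hK0 : 0 < K := by linarith
  have hq0 : 0 < q := sub_pos.2 (inv_lt_one_of_one_lt₀ hK1)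
  have hq1 : q < 1 := sub_lt_self _ (inv_pos.2 hK0)
  -- A fourth root: one root because `h` contracts by `q` over two steps, another because `h`
  -- controls the squared error.
  set ρ := √(√q) with hρ
  have hρ0 : 0 < ρ := Real.sqrt_pos.2 (Real.sqrt_pos.2 hq0)
  have hρ1 : ρ < 1 := by
    rw [hρ, Real.sqrt_lt' one_pos, one_pow, Real.sqrt_lt' one_pos, one_pow]
    exact hq1
  have hρ4 : ρ ^ 4 = q := by
    rw [show ρ ^ 4 = (ρ ^ 2) ^ 2 by ring, hρ, Real.sq_sqrt (Real.sqrt_nonneg _),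
      Real.sq_sqrt hq0.le]
  obtain ⟨D, hD, hDh⟩ := exists_geometric_bound (h := h) (T := T) hρ0
    (fun t _ => hanti (Nat.le_succ t)) (fun t ht => by
      have h1 := hboth t ht
      have h2 : 0 ≤ κ * ‖x t - a‖ ^ 2 / 4 := by positivity
      have h3 : K⁻¹ * h t ≤ K⁻¹ * (K * (h t - h (t + 2))) := by
        gcongr
        linarith
      rw [inv_mul_cancel_left₀ hK0.ne'] at h3
      rw [hρ4, hq]
      linarith) hρ1.le
  set G := 4 * K * D / κ with hG
  have hG0 : 0 < G := by positivity
  -- Adding `1` to `√G` makes the final inequality strict.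
  refine ⟨√G + 1, by positivity, T + 1, Nat.succ_pos _, ρ, ⟨hρ0, hρ1⟩, fun t ht => ?_⟩
  have hTt : T ≤ t := by lia
  have h1 : ‖x t - a‖ ^ 2 ≤ G * (ρ ^ t) ^ 2 := by
    have h1 := hboth t hTt
    have h2 := hh0 t
    have h3 := mul_nonneg hK0.le (hh0 (t + 2))
    have h4 := mul_le_mul_of_nonneg_left (hDh t hTt) hK0.le
    rw [hG, div_mul_eq_mul_div, le_div_iff₀ hκ]
    linarith
  have h2 : ‖x t - a‖ ≤ √G * ρ ^ t := by
    refine le_of_sq_le_sq ?_ (by positivity)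
    rwa [mul_pow, Real.sq_sqrt hG0.le]
  have h3 : 0 < ρ ^ t := by positivity
  linarith

/-! ### The isotropic and anisotropic models as families of linear maps. -/

/-- The value of the discrete gradient at a pixel. -/
noncomputable def gradAt (m : TQModel Ω Y) (p : Ω) : EuclideanSpace ℝ Ω →L[ℝ] EuclideanSpace ℝ (Fin 2) :=
  LinearMap.toContinuousLinearMap
    { toFun := fun u => WithLp.toLp 2 fun l => m.D l u p
      map_add' := fun u v => by ext l; simp
      map_smul' := fun c u => by ext l; simp }

/-- One component of the discrete gradient at a pixel. -/
noncomputable def gradCompAt (m : TQModel Ω Y) (i : Fin 2 × Ω) : EuclideanSpace ℝ Ω →L[ℝ] ℝ :=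
  LinearMap.toContinuousLinearMap
    { toFun := fun u => m.D i.1 u i.2
      map_add' := fun u v => by simp
      map_smul' := fun c u => by simp }

theorem norm_sq_gradAt (m : TQModel Ω Y) (p : Ω) (u : EuclideanSpace ℝ Ω) :
    ‖m.gradAt p u‖ ^ 2 = m.gradSq u p := by
  rw [EuclideanSpace.real_norm_sq_eq]
  rfl

theorem norm_sq_gradCompAt (m : TQModel Ω Y) (i : Fin 2 × Ω) (u : EuclideanSpace ℝ Ω) :
    ‖m.gradCompAt i u‖ ^ 2 = (m.D i.1 u i.2) ^ 2 := by
  rw [Real.norm_eq_abs, sq_abs]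
  rfl

end TQModel

theorem mainTheorem2 {Ω Y : Type*} [Fintype Ω] [NormedAddCommGroup Y] [InnerProductSpace ℝ Y]
    (m : TQModel Ω Y) (k : TQKind) (hF : LevelBounded (m.F k))
    (L : ℝ≥0) (hL : LipschitzWith L (gradient m.f))
    (M : EuclideanSpace ℝ Ω →ₗ[ℝ] EuclideanSpace ℝ Ω) (hM : IsMetricOp M)
    (hML : ∀ u, (L : ℝ) * ‖u‖ ^ 2 ≤ sqNormM M u)
    (β : ℕ → ℝ) (x y ξ : ℕ → EuclideanSpace ℝ Ω) (hx : IsPreDCAe m k M β x y ξ)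
    (xbar : EuclideanSpace ℝ Ω) (hlim : Tendsto x atTop (𝓝 xbar))
    (hE : IsKLFunctionWithExponent (m.E k M) (1 / 2)) :
    ∃ c₁ : ℝ, 0 < c₁ ∧ ∃ t₀ : ℕ, 0 < t₀ ∧ ∃ η ∈ Set.Ioo (0 : ℝ) 1,
      ∀ t, t₀ < t → ‖x t - xbar‖ < c₁ * η ^ t := by
  cases k with
  | iso =>
    exact m.linear_convergence .iso hF m.gradAt
      (fun u => by simp only [TQModel.norm_sq_gradAt, TQModel.P₁])
      (fun u => by simp only [TQModel.norm_sq_gradAt, TQModel.P₂])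
      L hL M hM.symm hML β x y ξ hx xbar hlim
  | aniso =>
    exact m.linear_convergence .aniso hF m.gradCompAt
      (fun u => by simp only [TQModel.norm_sq_gradCompAt, TQModel.P₁, Fintype.sum_prod_type])
      (fun u => by simp only [TQModel.norm_sq_gradCompAt, TQModel.P₂, Fintype.sum_prod_type])
      L hL M hM.symm hML β x y ξ hx xbar hlim
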